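/- Let $V$ be a finite-dimensional real vector space with dual $V^*$, $A \subset V$ a nonempty finite set and $\alpha \in V$. For a finite set $B$ in a finite-dimensional real vector space $W$ and $\eta \in \mathbb{R}^B$, let $Q_\eta = \mathrm{conv}\{(b,r) : b \in B,\ r \le -\eta(b)\} \subset W \times \mathbb{R}$. The coherent subdivision $\mathcal{S}_\eta$ induced by $\eta$ is the collection of marked polytopes $(Q', B')$, one for each nonempty compact face $F$ of $Q_\eta$, where $Q'$ is the projection of $F$ to $W$ and $B' = \{b \in B : (b,-\eta(b)) \in F\}$. The secondary fan $\mathcal{F}_{\mathrm{Sec}\, B}$ in $\mathbb{R}^B$ consists of the closures of the sets $C^\circ_{\mathcal{S}} = \{\eta : \mathcal{S}_\eta = \mathcal{S}\}$, with $\mathcal{S}$ ranging over the coherent subdivisions. The lineality space of a fan is the largest linear subspace stabilizing every cone of the fan under translation. For $\eta \in \mathbb{R}^A$ let $f_\eta(u) = \min\{u(a) + \eta(a) : a \in A\}$ for $u \in V^*$, and let $\mathcal{P}_\eta$ be the polyhedral complex in $V^*$ whose cells are the maximal domains of linearity of $f_\eta$ and their nonempty faces. Each cell $\sigma$ is marked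 by $\psi_\eta(\sigma) = \{a \in A : f_\eta(u) = u(a) + \eta(a) \text{ for all } u \in \sigma\}$. For $c \in \mathbb{R}$, color $\sigma$ blue if $f_\eta(u) < u(\alpha) + c$ for all $u$ in the relative interior of $\sigma$, red if $f_\eta(u) > u(\alpha) + c$ for all such $u$, and purple if $f_\eta(u) = u(\alpha) + c$ for some such $u$. This is the painted tropical $A$-complex of $(\eta, c)$ relative to $\alpha$. Those of $(\eta_1,c_1)$ and $(\eta_2,c_2)$ are isotopic if $\mathcal{S}_{\eta_1} = \mathcal{S}_{\eta_2}$ and the isomorphism of face lattices $\mathcal{P}_{\eta_1} \to \mathcal{P}_{\eta_2}$ that respects the markings preserves the colors. Let $\mathcal{F}_{A,\alpha}$ be the fan in $\mathbb{R}^A \times \mathbb{R}$ whose cones are the closures of the isotopy classes, each regarded as a set of pairs $(\eta, c)$. Put $\rho = (\alpha,1)$, $\beta = (\alpha,2)$ and $\bar{A}_\alpha = \{(a,0) : a \in A\} \cup \{\rho, \beta\} \subset V \times \mathbb{R}$, and let $L$ be the lineality space of $\mathcal{F}_{\mathrm{Sec}\, \bar{A}_\alpha}$. For a fan $\mathcal{F}$,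 let $\mathcal{F} \times \mathbb{R}$ be the fan with cones $C \times \mathbb{R}$, $C \in \mathcal{F}$. Theorem. The fan $\mathcal{F}_{A,\alpha} \times \mathbb{R}$ is isomorphic to $\mathcal{F}_{\mathrm{Sec}\, \bar{A}_\alpha}$. More precisely, let $i : \mathbb{R}^A \times \mathbb{R} \to \mathbb{R}^{\bar{A}_\alpha}$ be the linear map $$i(\eta, c) = c\, e_\rho + c\, e_\beta + \sum_{a \in A} \eta(a)\, e_{(a,0)}.$$ Then: (1) $i$ is injective and transverse to $L$, that is, $\mathrm{im}(i) + L = \mathbb{R}^{\bar{A}_\alpha}$; (2) the images under $i$ of the cones of $\mathcal{F}_{A,\alpha}$ are exactly the intersections of the cones of $\mathcal{F}_{\mathrm{Sec}\, \bar{A}_\alpha}$ with $\mathrm{im}(i)$; (3) there is a linear isomorphism $T : (\mathbb{R}^A \times \mathbb{R}) \times \mathbb{R} \to \mathbb{R}^{\bar{A}_\alpha}$ with $T(\eta, c, 0) = i(\eta, c)$ and $T(0, 0, t) \in L$ for all $\eta, c, t$, which maps the cones of $\mathcal{F}_{A,\alpha} \times \mathbb{R}$ bijectively onto the cones of $\mathcal{F}_{\mathrm{Sec}\,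 \bar{A}_\alpha}$. -/

import Mathlib

noncomputable section

namespace PaintedTropical

open Set

section Configurations

variable {V : Type*} [NormedAddCommGroup V] [NormedSpace ℝ V]

/-- The polyhedron `Q_η = conv {(a, r) : a ∈ A, r ≤ -η(a)}` in `V × ℝ`. -/
def liftedPolyhedron {A : Finset V} (η : A → ℝ) : Set (V × ℝ) :=
  convexHull ℝ {p : V × ℝ | ∃ a : A, p.1 = (a : V) ∧ p.2 ≤ -η a}

/-- The coherent subdivision `S_η` induced by `η`: the collection of the marked polytopes `(Q', A')`
obtained from the nonempty compact faces `F` of `Q_η` (these form its upper boundary), where `Q'`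
is the projection of `F` to `V` and `A'` consists of the `a` whose lift `(a, -η(a))` lies on `F`. -/
def coherentSubdivision {A : Finset V} (η : A → ℝ) : Set (Set V × Set A) :=
  {P | ∃ F : Set (V × ℝ), IsExposed ℝ (liftedPolyhedron η) F ∧ F.Nonempty ∧ IsCompact F ∧
    P.1 = Prod.fst '' F ∧ P.2 = {a : A | ((a : V), -η a) ∈ F}}

/-- The relatively open cone `C°_S` of all functions inducing the subdivision `S`. -/
def openSecondaryCone {A : Finset V} (S : Set (Set V × Set A)) : Set (A → ℝ) :=
  {η | coherentSubdivision η = S}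

/-- The secondary fan of `A`: the closures of the sets `C°_S`, with `S` coherent. -/
def secondaryFan (A : Finset V) : Set (Set (A → ℝ)) :=
  {C | ∃ S : Set (Set V × Set A), (∃ η : A → ℝ, coherentSubdivision η = S) ∧
    C = closure (openSecondaryCone S)}

/-- The tropical polynomial `f_η(u) = min {u(a) + η(a) : a ∈ A}` on the dual space of `V`
(a minimum over a finite set, which is nonempty wherever this is used). -/
def tropicalPoly {A : Finset V} (η : A → ℝ) (u : V →L[ℝ] ℝ) : ℝ :=
  ⨅ a : A, (u (a : V) + η a)

/-- The polyhedral complex `P_η` in the dual space, as its set of (nonempty) cells: the nonempty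
sets on which all members of some nonempty `B ⊆ A` attain the minimum `f_η`. These are
the maximal domains of linearity of `f_η` together with all their nonempty faces. -/
def tropicalComplex {A : Finset V} (η : A → ℝ) : Set (Set (V →L[ℝ] ℝ)) :=
  {σ | σ.Nonempty ∧ ∃ B : Set A, B.Nonempty ∧
    σ = {u | ∀ a ∈ B, tropicalPoly η u = u (a : V) + η a}}

/-- The marking `ψ_η` of a cell: the `a` attaining the minimum on the whole cell. -/
def tropicalMarking {A : Finset V} (η : A → ℝ) (σ : Set (V →L[ℝ] ℝ)) : Set A :=
  {a : A | ∀ u ∈ σ, tropicalPoly η u = u (a : V) + η a}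

/-- The three colors blue, purple, red. -/
inductive Color : Type
  | blue
  | purple
  | red

open Classical in
/-- The color `κ_{η,c}(σ)` of a cell relative to `α`: blue if `f_η(u) < u(α) + c` on the whole
relative interior, purple if equality holds somewhere on it, and red otherwise. By convexity of the
cell and continuity, the last case means `f_η(u) > u(α) + c` on the whole relative interior. -/
def cellColor {A : Finset V} (α : V) (η : A → ℝ) (c : ℝ) (σ : Set (V →L[ℝ] ℝ)) : Color :=
  if ∀ u ∈ intrinsicInterior ℝ σ, tropicalPoly η u < u α + c then Color.blue
  else if ∃ u ∈ intrinsicInterior ℝ σ, tropicalPoly η u = u α + c then Color.purple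
  else Color.red

/-- `(η₁, c₁) ∼ (η₂, c₂)`: the painted tropical `A`-complexes of the two pairs are isotopic, that is,
`η₁` and `η₂` induce the same coherent subdivision, and the isomorphism of face lattices of
`P_{η₁}` and `P_{η₂}` that respects the markings by subsets of `A` preserves the colors. -/
def PaintedIsotopic {A : Finset V} (α : V) (p q : (A → ℝ) × ℝ) : Prop :=
  coherentSubdivision p.1 = coherentSubdivision q.1 ∧
    ∃ ι : tropicalComplex p.1 ≃o tropicalComplex q.1,
      (∀ σ, tropicalMarking q.1 (ι σ : Set (V →L[ℝ] ℝ)) = tropicalMarking p.1 σ) ∧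
      (∀ σ, cellColor α q.1 q.2 (ι σ : Set (V →L[ℝ] ℝ)) = cellColor α p.1 p.2 σ)

/-- The painting fan `F_{A,α}` in `ℝ^A × ℝ`: the closures of the isotopy classes of painted tropical
`A`-complexes relative to `α`. -/
def paintingFan (A : Finset V) (α : V) : Set (Set ((A → ℝ) × ℝ)) :=
  {C | ∃ p : (A → ℝ) × ℝ, C = closure {q | PaintedIsotopic α p q}}

open Classical in
/-- The configuration `Ā_α = {(a, 0) : a ∈ A} ∪ {(α, 1), (α, 2)}` in `V × ℝ`. -/
def extendedConfig (A : Finset V) (α : V) : Finset (V × ℝ) :=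
  A.image (fun a => (a, (0 : ℝ))) ∪ {(α, 1), (α, 2)}

/-- The point `ρ = (α, 1)` of `Ā_α`. -/
def rho (A : Finset V) (α : V) : extendedConfig A α :=
  ⟨(α, 1), by simp [extendedConfig]⟩

/-- The point `β = (α, 2)` of `Ā_α`. -/
def beta (A : Finset V) (α : V) : extendedConfig A α :=
  ⟨(α, 2), by simp [extendedConfig]⟩

/-- The point `(a, 0)` of `Ā_α`. -/
def base (A : Finset V) (α : V) (a : A) : extendedConfig A α :=
  ⟨((a : V), 0), by simp [extendedConfig]⟩

open Classical in
/-- The linear map `i(η, c) = c e_ρ + c e_β + ∑ η(a) e_{(a,0)}`. -/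
def paintingInclusion (A : Finset V) (α : V) :
    ((A → ℝ) × ℝ) →ₗ[ℝ] (extendedConfig A α → ℝ) where
  toFun p := p.2 • Pi.single (rho A α) (1 : ℝ) + p.2 • Pi.single (beta A α) (1 : ℝ) +
    ∑ a : A, p.1 a • Pi.single (base A α a) (1 : ℝ)
  map_add' p q := by
    simp only [Prod.snd_add, Prod.fst_add, Pi.add_apply, add_smul, Finset.sum_add_distrib]
    abel
  map_smul' t p := by
    simp only [Prod.smul_snd, Prod.smul_fst, Pi.smul_apply, smul_eq_mul, mul_smul, smul_add,
      Finset.smul_sum, RingHom.id_apply]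

end Configurations

section Fans

variable {E E' : Type*} [AddCommGroup E] [Module ℝ E] [AddCommGroup E'] [Module ℝ E']

/-- The fan `F × ℝ` with cones `C × ℝ`. -/
def fanProdReal (F : Set (Set E)) : Set (Set (E × ℝ)) :=
  {D | ∃ C ∈ F, D = C ×ˢ (univ : Set ℝ)}

/-- The restriction of `F` to a subspace `U`: the intersections of the cones with `U`. -/
def fanRestrict (F : Set (Set E)) (U : Submodule ℝ E) : Set (Set E) :=
  {D | ∃ C ∈ F, D = C ∩ (U : Set E)}

/-- A linear isomorphism `T` is an isomorphism from the fan `F` to the fan `G` if the images under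
`T` of the cones of `F` are exactly the cones of `G`. -/
def IsFanIso (F : Set (Set E)) (G : Set (Set E')) (T : E ≃ₗ[ℝ] E') : Prop :=
  {D : Set E' | ∃ C ∈ F, D = T '' C} = G

/-- The lineality space of `F`: the largest linear subspace stabilizing all cones of `F` under
translation. -/
def lineality (F : Set (Set E)) : Submodule ℝ E where
  carrier := {v | ∀ C ∈ F, ∀ t : ℝ, ∀ x ∈ C, x + t • v ∈ C}
  zero_mem' := by
    intro C _ t x hx
    simpa using hx
  add_mem' := by
    intro v w hv hw C hC t x hx
    rw [smul_add, ← add_assoc]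
    exact hw C hC t _ (hv C hC t x hx)
  smul_mem' := by
    intro s v hv C hC t x hx
    rw [smul_smul]
    exact hv C hC (t * s) x hx

end Fans

end PaintedTropical

end

/-! Everything is reduced to the family of minimizer sets `argminSet η u`, where `u` runs over all
functionals. A compact exposed face of `Q_η` is the locus where some `r - u(w)` is maximal, and it
is the hull of the lifts of the minimizers of `u + η`. Hence `S_η` and this family determine each
other (`coherentSubdivision_eq_iff`). The same sets mark the relatively open cells of `P_η`.

A painting is encoded by its `signature`: the pairs of a minimizer set and a sign of the gap `g =
f_η(u) - u(α) - c` occurring together. Colors and signatures carry the same information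
(`paintedIsotopic_iff`), because on an open cell the gap is affine with linear part determined by
the marking.

For the weights `i(η, c)` and the functional `(u, t)`, subtract `u(α) + c` from all values. The
points `(a, 0)` then have minimum `g`, while `ρ` and `β` have values `t` and `2t`. Which of `g, t,
2t` are minimal is invariant under positive scaling, so only the sign of `g` matters; conversely, a
suitable `t` makes that sign visible. Thus isotopy classes are exactly the pullbacks under `i` of
the open secondary cones (`range_argminSet_paintingInclusion_eq_iff`).

The height function `h`, equal to 0, 1, 2 on `(a, 0)`, `ρ`, `β`, is the restriction of a linear
functional. Adding multiples of it only translates the dual space, so it lies in the lineality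
space. Since `h` spans a complement of the image of `i`, `T((η, c), t) = i(η, c) + t h` identifies
the fans. -/

noncomputable section

namespace PaintedTropical

open Set

/-! ### Minimizer sets of `u + η` -/

section Minimizers

variable {V : Type*} [NormedAddCommGroup V] [NormedSpace ℝ V]

/-- The elements of `A` at which `u + η` is minimal. -/
def argminSet {A : Finset V} (η : A → ℝ) (u : V →L[ℝ] ℝ) : Set A :=
  {a | ∀ b : A, u (a : V) + η a ≤ u (b : V) + η b}

theorem mem_argminSet {A : Finset V} {η : A → ℝ} {u : V →L[ℝ] ℝ} {a : A} :
    a ∈ argminSet η u ↔ ∀ b : A, u (a : V) + η a ≤ u (b : V) + η b := Iff.rfl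

theorem argminSet_nonempty {A : Finset V} (hA : A.Nonempty) (η : A → ℝ) (u : V →L[ℝ] ℝ) :
    (argminSet η u).Nonempty := by
  have : Nonempty A := hA.to_subtype
  obtain ⟨a, ha⟩ := Finite.exists_min (fun a : A => u (a : V) + η a)
  exact ⟨a, ha⟩

theorem tropicalPoly_eq_of_mem {A : Finset V} {η : A → ℝ} {u : V →L[ℝ] ℝ} {a : A}
    (ha : a ∈ argminSet η u) : tropicalPoly η u = u (a : V) + η a := by
  have : Nonempty A := ⟨a⟩
  exact le_antisymm (ciInf_le (Set.finite_range _).bddBelow a) (le_ciInf ha)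

theorem tropicalPoly_eq_iff {A : Finset V} {η : A → ℝ} {u : V →L[ℝ] ℝ} {a : A} :
    tropicalPoly η u = u (a : V) + η a ↔ a ∈ argminSet η u := by
  refine ⟨fun h b => ?_, tropicalPoly_eq_of_mem⟩
  rw [← h]
  exact ciInf_le (Set.finite_range _).bddBelow b

theorem lt_of_mem_of_notMem_argminSet {A : Finset V} {η : A → ℝ} {u : V →L[ℝ] ℝ} {a b : A}
    (ha : a ∈ argminSet η u) (hb : b ∉ argminSet η u) :
    u (a : V) + η a < u (b : V) + η b := by
  by_contra! h
  exact hb fun c => h.trans (ha c)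

theorem argminSet_eq_of_forall {A : Finset V} {η : A → ℝ} {u : V →L[ℝ] ℝ} {M : Set A} {b : A}
    (heq : ∀ a : A, a ∈ M → u (a : V) + η a = u (b : V) + η b)
    (hlt : ∀ a : A, a ∉ M → u (b : V) + η b < u (a : V) + η a) : argminSet η u = M := by
  have hmin : ∀ a : A, u (b : V) + η b ≤ u (a : V) + η a := fun a => by
    by_cases ha : a ∈ M
    · exact (heq a ha).ge
    · exact (hlt a ha).le
  ext a
  refine ⟨fun h => ?_, fun h c => (heq a h).le.trans (hmin c)⟩
  by_contra ha
  exact (hlt a ha).not_ge (h b)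

end Minimizers

/-! ### Compact faces of the lifted polyhedron and coherent subdivisions -/

section Faces

variable {V : Type*} [NormedAddCommGroup V] [NormedSpace ℝ V] {A : Finset V}

theorem lift_mem_liftedPolyhedron (η : A → ℝ) (a : A) :
    ((a : V), -η a) ∈ liftedPolyhedron η :=
  subset_convexHull ℝ _ ⟨a, rfl, le_rfl⟩

theorem sub_mem_liftedPolyhedron {η : A → ℝ} {x : V × ℝ} (hx : x ∈ liftedPolyhedron η) {s : ℝ}
    (hs : 0 ≤ s) : (0, -s) + x ∈ liftedPolyhedron η := by
  have hconv : Convex ℝ ((fun z : V × ℝ => (0, -s) + z) ⁻¹' liftedPolyhedron η) :=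
    (convex_convexHull ℝ _).translate_preimage_right _
  refine convexHull_min ?_ hconv hx
  rintro ⟨w, r⟩ ⟨a, h1, h2⟩
  refine subset_convexHull ℝ _ ⟨a, by simpa using h1, ?_⟩
  simp only [Prod.snd_add] at h2 ⊢
  linarith

theorem exists_weights_of_mem_liftedPolyhedron {η : A → ℝ} {x : V × ℝ}
    (hx : x ∈ liftedPolyhedron η) :
    ∃ w : A → ℝ, (∀ a, 0 ≤ w a) ∧ ∑ a, w a = 1 ∧ ∑ a, w a • (a : V) = x.1 ∧
      x.2 ≤ ∑ a, w a * (-η a) := by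
  classical
  refine convexHull_min (t := {x : V × ℝ | ∃ w : A → ℝ, (∀ a, 0 ≤ w a) ∧ ∑ a, w a = 1 ∧
    ∑ a, w a • (a : V) = x.1 ∧ x.2 ≤ ∑ a, w a * (-η a)}) ?_ ?_ hx
  · rintro ⟨v, r⟩ ⟨a, h1, h2⟩
    refine ⟨Pi.single a 1, fun b => ?_, by simp, ?_, ?_⟩
    · by_cases h : b = a
      · subst h; simp
      · simp [h]
    · simp only [Pi.single_apply, ite_smul, one_smul, zero_smul] at h1 ⊢
      simp [h1]
    · simpa [Pi.single_apply] using h2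
  · rintro x ⟨w, h1, h2, h3, h4⟩ y ⟨w', h1', h2', h3', h4'⟩ s t hs ht hst
    refine ⟨fun a => s * w a + t * w' a, fun a => ?_, ?_, ?_, ?_⟩
    · have := h1 a
      have := h1' a
      positivity
    · rw [Finset.sum_add_distrib, ← Finset.mul_sum, ← Finset.mul_sum, h2, h2']
      simpa using hst
    · simp only [add_smul, mul_smul, Finset.sum_add_distrib, ← Finset.smul_sum, h3, h3']
      rfl
    · simp only [add_mul, mul_assoc, Finset.sum_add_distrib, ← Finset.mul_sum]
      exact add_le_add (mul_le_mul_of_nonneg_left h4 hs) (mul_le_mul_of_nonneg_left h4' ht)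

/-- The compact face of `Q_η` on which `(w, r) ↦ r - u(w)` is maximal. -/
def upperFace (η : A → ℝ) (u : V →L[ℝ] ℝ) : Set (V × ℝ) :=
  {x ∈ liftedPolyhedron η | ∀ y ∈ liftedPolyhedron η, y.2 - u y.1 ≤ x.2 - u x.1}

theorem sub_le_of_mem_liftedPolyhedron {η : A → ℝ} {u : V →L[ℝ] ℝ} {a : A}
    (ha : a ∈ argminSet η u) {x : V × ℝ} (hx : x ∈ liftedPolyhedron η) :
    x.2 - u x.1 ≤ -η a - u a := by
  have hconv : Convex ℝ {x : V × ℝ | x.2 - u x.1 ≤ -η a - u a} := by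
    exact convex_halfSpace_le (𝕜 := ℝ)
      (LinearMap.snd ℝ V ℝ - u.toLinearMap ∘ₗ LinearMap.fst ℝ V ℝ).isLinear _
  refine convexHull_min ?_ hconv hx
  rintro ⟨v, r⟩ ⟨b, rfl, h2⟩
  have := ha b
  simp only [mem_ofPred_eq] at h2 ⊢
  linarith

theorem lift_mem_upperFace {η : A → ℝ} {u : V →L[ℝ] ℝ} {a : A} :
    ((a : V), -η a) ∈ upperFace η u ↔ a ∈ argminSet η u := by
  constructor
  · intro h b
    have := h.2 _ (lift_mem_liftedPolyhedron η b)
    simp only at this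
    linarith
  · exact fun h => ⟨lift_mem_liftedPolyhedron η a, fun y hy => sub_le_of_mem_liftedPolyhedron h hy⟩

/-- Maximality forces a weighted sum of nonnegative slacks to vanish, so the weights live on the
minimizers and no downward slack remains. Compactness and the projection of the face follow from
this description. -/
theorem upperFace_eq_convexHull (hA : A.Nonempty) (η : A → ℝ) (u : V →L[ℝ] ℝ) :
    upperFace η u = convexHull ℝ ((fun a : A => ((a : V), -η a)) '' argminSet η u) := by
  obtain ⟨a₀, ha₀⟩ := argminSet_nonempty hA η u
  apply Subset.antisymm
  · rintro x ⟨hx, hmax⟩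
    obtain ⟨w, h1, h2, h3, h4⟩ := exists_weights_of_mem_liftedPolyhedron hx
    have hle := hmax _ (lift_mem_liftedPolyhedron η a₀)
    have hux : u x.1 = ∑ a, w a * u (a : V) := by rw [← h3]; simp
    have hterm : ∀ a, 0 ≤ w a * ((u (a : V) + η a) - (u (a₀ : V) + η a₀)) := fun a =>
      mul_nonneg (h1 a) (sub_nonneg.2 (ha₀ a))
    have hsum : ∑ a, w a * ((u (a : V) + η a) - (u (a₀ : V) + η a₀)) =
        u x.1 - ∑ a, w a * (-η a) - (u (a₀ : V) + η a₀) := by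
      simp only [mul_sub, mul_add, Finset.sum_sub_distrib, Finset.sum_add_distrib,
        ← Finset.sum_mul, h2, hux, mul_neg, Finset.sum_neg_distrib]
      ring
    simp only at hle
    have hnn := Finset.sum_nonneg fun a (_ : a ∈ Finset.univ) => hterm a
    have hzero : ∑ a, w a * ((u (a : V) + η a) - (u (a₀ : V) + η a₀)) = 0 := by linarith
    have hsupp : ∀ a, a ∉ argminSet η u → w a = 0 := by
      intro a ha
      have h := (Finset.sum_eq_zero_iff_of_nonneg fun a _ => hterm a).1 hzero a (Finset.mem_univ a)
      exact (mul_eq_zero.1 h).resolve_right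
        (sub_ne_zero.2 (lt_of_mem_of_notMem_argminSet ha₀ ha).ne')
    have hx2 : x.2 = ∑ a, w a * (-η a) := by linarith
    have hxeq : x = ∑ a, w a • ((a : V), -η a) := by
      refine Prod.ext ?_ ?_
      · rw [Prod.fst_sum, ← h3]; rfl
      · rw [Prod.snd_sum, hx2]; rfl
    classical
    have hrestrict : ∀ {E : Type _} [AddCommGroup E] [Module ℝ E] (z : A → E),
        ∑ a ∈ Finset.univ.filter (· ∈ argminSet η u), w a • z a = ∑ a, w a • z a := by
      intro E _ _ z
      refine Finset.sum_subset (Finset.filter_subset _ _) fun a _ ha => ?_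
      rw [hsupp a (by simpa using ha), zero_smul]
    rw [hxeq, ← hrestrict]
    refine (convex_convexHull ℝ _).sum_mem (fun a _ => h1 a) ?_ ?_
    · rw [← h2]
      refine Finset.sum_subset (Finset.filter_subset _ _) fun a _ ha => ?_
      exact hsupp a (by simpa using ha)
    · intro a ha
      exact subset_convexHull ℝ _ ⟨a, by simpa using ha, rfl⟩
  · refine convexHull_min ?_ ?_
    · rintro _ ⟨a, ha, rfl⟩
      exact lift_mem_upperFace.2 ha
    · rintro x ⟨hx, hx'⟩ y ⟨hy, hy'⟩ s t hs ht hst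
      refine ⟨convex_convexHull ℝ _ hx hy hs ht hst, fun z hz => ?_⟩
      have e1 := mul_le_mul_of_nonneg_left (hx' z hz) hs
      have e2 := mul_le_mul_of_nonneg_left (hy' z hz) ht
      have e3 : z.2 - u z.1 = s * (z.2 - u z.1) + t * (z.2 - u z.1) := by
        rw [← add_mul, hst, one_mul]
      simp only [Prod.snd_add, Prod.fst_add, Prod.smul_snd, Prod.smul_fst, map_add, map_smul,
        smul_eq_mul]
      linarith

theorem isExposed_upperFace (η : A → ℝ) (u : V →L[ℝ] ℝ) :
    IsExposed ℝ (liftedPolyhedron η) (upperFace η u) := fun _ =>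
  ⟨ContinuousLinearMap.snd ℝ V ℝ - u.comp (ContinuousLinearMap.fst ℝ V ℝ), rfl⟩

theorem isCompact_upperFace (hA : A.Nonempty) (η : A → ℝ) (u : V →L[ℝ] ℝ) :
    IsCompact (upperFace η u) := by
  rw [upperFace_eq_convexHull hA]
  exact (Set.toFinite _).isCompact_convexHull (𝕜 := ℝ)

theorem fst_image_upperFace (hA : A.Nonempty) (η : A → ℝ) (u : V →L[ℝ] ℝ) :
    Prod.fst '' upperFace η u = convexHull ℝ ((fun a : A => (a : V)) '' argminSet η u) := by
  rw [upperFace_eq_convexHull hA]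
  have := (LinearMap.fst ℝ V ℝ).image_convexHull
    ((fun a : A => ((a : V), -η a)) '' argminSet η u)
  rw [image_image] at this
  exact this

/-- The exposing functional has nonnegative vertical coefficient because `Q_η` is closed downwards.
Coefficient zero would put a downward ray in the face, against compactness; a positive one can be
normalized to 1. -/
theorem exists_eq_upperFace {η : A → ℝ} {F : Set (V × ℝ)}
    (hF : IsExposed ℝ (liftedPolyhedron η) F) (hne : F.Nonempty) (hc : IsCompact F) :
    ∃ u : V →L[ℝ] ℝ, F = upperFace η u := by
  obtain ⟨l, hl⟩ := hF hne
  obtain ⟨x, hx⟩ := hne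
  have hxF := hx
  rw [hl] at hx
  have hdecomp : ∀ y : V × ℝ, l y = l (y.1, 0) + y.2 * l (0, 1) := by
    intro y
    rw [← smul_eq_mul, ← map_smul, ← map_add]
    congr 1
    ext <;> simp
  have hdown : ∀ s : ℝ, l ((0, -s) + x) = l x - s * l (0, 1) := by
    intro s
    rw [hdecomp ((0, -s) + x), hdecomp x]
    simp only [Prod.fst_add, Prod.snd_add, zero_add]
    ring
  have hnn : 0 ≤ l (0, 1) := by
    have := hx.2 _ (sub_mem_liftedPolyhedron hx.1 zero_le_one)
    rw [hdown] at this
    linarith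
  have hpos : 0 < l (0, 1) := by
    refine lt_of_le_of_ne hnn fun h0 => ?_
    obtain ⟨m, hm⟩ := (hc.image continuous_snd).bddBelow
    -- This point has height `m - 1`, below the lower bound `m` of the heights in `F`.
    have hmem : (0, -(x.2 - m + 1)) + x ∈ F := by
      have hmx := hm (mem_image_of_mem _ hxF)
      rw [hl]
      refine ⟨sub_mem_liftedPolyhedron hx.1 (by linarith), fun y hy => ?_⟩
      rw [hdown, ← h0]
      simpa using hx.2 y hy
    have := hm (mem_image_of_mem _ hmem)
    simp only [Prod.snd_add] at this
    linarith
  refine ⟨-((l (0, 1))⁻¹ • l.comp (ContinuousLinearMap.inl ℝ V ℝ)), ?_⟩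
  have hval : ∀ y : V × ℝ, y.2 - (-((l (0, 1))⁻¹ • l.comp (ContinuousLinearMap.inl ℝ V ℝ))) y.1 =
      (l (0, 1))⁻¹ * l y := by
    intro y
    rw [hdecomp y]
    simp only [neg_apply, smul_apply,
      ContinuousLinearMap.comp_apply, ContinuousLinearMap.inl_apply, smul_eq_mul]
    field_simp
    ring
  rw [hl, upperFace]
  ext y
  simp only [hval, mem_ofPred_eq, mul_le_mul_iff_right₀ (inv_pos.2 hpos)]

theorem coherentSubdivision_eq (hA : A.Nonempty) (η : A → ℝ) :
    coherentSubdivision η =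
      (fun M : Set A => (convexHull ℝ ((fun a : A => (a : V)) '' M), M)) ''
        range (argminSet η) := by
  ext ⟨Q, B⟩
  constructor
  · rintro ⟨F, hF, hne, hc, h1, h2⟩
    obtain ⟨u, rfl⟩ := exists_eq_upperFace hF hne hc
    have hB : B = argminSet η u := by
      simp only [lift_mem_upperFace] at h2
      exact h2
    refine ⟨argminSet η u, mem_range_self u, ?_⟩
    simp only at h1
    simp only [← fst_image_upperFace hA, h1, hB]
  · rintro ⟨_, ⟨u, rfl⟩, h⟩
    obtain ⟨rfl, rfl⟩ := Prod.mk.inj h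
    obtain ⟨a, ha⟩ := argminSet_nonempty hA η u
    refine ⟨upperFace η u, isExposed_upperFace η u, ⟨_, lift_mem_upperFace.2 ha⟩,
      isCompact_upperFace hA η u, (fst_image_upperFace hA η u).symm, ?_⟩
    simp only [lift_mem_upperFace]
    rfl

theorem coherentSubdivision_eq_iff (hA : A.Nonempty) (η η' : A → ℝ) :
    coherentSubdivision η = coherentSubdivision η' ↔
      range (argminSet η) = range (argminSet η') := by
  rw [coherentSubdivision_eq hA, coherentSubdivision_eq hA]
  refine Function.Injective.eq_iff (Set.image_injective.2 fun M M' h => (Prod.mk.inj h).2)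

end Faces

/-! ### Cells of the tropical complex, their relative interiors and markings -/

section Cells

variable {V : Type*} [NormedAddCommGroup V] [NormedSpace ℝ V] {A : Finset V}

/-- The cell of `P_η` on which all elements of `M` attain the minimum. -/
def cellOf (η : A → ℝ) (M : Set A) : Set (V →L[ℝ] ℝ) :=
  {u | M ⊆ argminSet η u}

theorem mem_tropicalComplex_iff {η : A → ℝ} {σ : Set (V →L[ℝ] ℝ)} :
    σ ∈ tropicalComplex η ↔ σ.Nonempty ∧ ∃ B : Set A, B.Nonempty ∧ σ = cellOf η B := by
  simp only [tropicalComplex, tropicalPoly_eq_iff]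
  rfl

theorem mem_tropicalMarking_iff {η : A → ℝ} {σ : Set (V →L[ℝ] ℝ)} {a : A} :
    a ∈ tropicalMarking η σ ↔ ∀ u ∈ σ, a ∈ argminSet η u := by
  simp only [tropicalMarking, tropicalPoly_eq_iff]
  rfl

theorem cellOf_tropicalMarking {η : A → ℝ} {σ : Set (V →L[ℝ] ℝ)} (hσ : σ ∈ tropicalComplex η) :
    cellOf η (tropicalMarking η σ) = σ := by
  obtain ⟨-, B, -, rfl⟩ := mem_tropicalComplex_iff.1 hσ
  ext u
  refine ⟨fun h a ha => h (mem_tropicalMarking_iff.2 fun v hv => hv ha), fun h a ha => ?_⟩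
  exact mem_tropicalMarking_iff.1 ha u h

theorem tropicalMarking_cellOf_argminSet (η : A → ℝ) (u : V →L[ℝ] ℝ) :
    tropicalMarking η (cellOf η (argminSet η u)) = argminSet η u := by
  ext a
  rw [mem_tropicalMarking_iff]
  exact ⟨fun h => h u Subset.rfl, fun h v hv => hv h⟩

theorem cellOf_argminSet_mem (hA : A.Nonempty) (η : A → ℝ) (u : V →L[ℝ] ℝ) :
    cellOf η (argminSet η u) ∈ tropicalComplex η :=
  mem_tropicalComplex_iff.2 ⟨⟨u, Subset.rfl⟩, _, argminSet_nonempty hA η u, rfl⟩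

theorem convex_cellOf (η : A → ℝ) (M : Set A) : Convex ℝ (cellOf η M) := by
  intro u hu v hv s t hs ht hst a ha b
  have e1 := mul_le_mul_of_nonneg_left (hu ha b) hs
  have e2 := mul_le_mul_of_nonneg_left (hv ha b) ht
  have e3 : ∀ r : ℝ, r = s * r + t * r := fun r => by rw [← add_mul, hst, one_mul]
  have e4 := e3 (η a)
  have e5 := e3 (η b)
  simp only [add_apply, smul_apply, smul_eq_mul]
  linarith

theorem eventually_argminSet_add_smul {η : A → ℝ} {u v : V →L[ℝ] ℝ} {b : A}
    (hb : b ∈ argminSet η u) (hv : ∀ a : A, a ∈ argminSet η u → v (a : V) = v (b : V)) :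
    ∀ᶠ t : ℝ in nhds 0, argminSet η (u + t • v) = argminSet η u := by
  have hlt : ∀ᶠ t : ℝ in nhds 0, ∀ a : A, a ∉ argminSet η u →
      (u + t • v) (b : V) + η b < (u + t • v) (a : V) + η a := by
    rw [Filter.eventually_all]
    intro a
    by_cases ha : a ∈ argminSet η u
    · simp [ha]
    · have h0 : u (b : V) + 0 * v (b : V) + η b < u (a : V) + 0 * v (a : V) + η a := by
        simpa using lt_of_mem_of_notMem_argminSet hb ha
      have hev := (ContinuousAt.eventually_lt (f := fun t : ℝ => u (b : V) + t * v (b : V) + η b)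
        (g := fun t : ℝ => u (a : V) + t * v (a : V) + η a) (x₀ := 0)
        (by fun_prop) (by fun_prop) h0)
      filter_upwards [hev] with t ht _
      simpa using ht
  filter_upwards [hlt] with t ht
  refine argminSet_eq_of_forall (fun a ha => ?_) ht
  have : u (a : V) + η a = u (b : V) + η b := le_antisymm (ha b) (hb a)
  simp only [add_apply, smul_apply, smul_eq_mul, hv a ha]
  linarith

/-- The ties among the minimizers define an affine subspace containing the span of the cell; the
strict inequalities for the other elements are open, and where both hold the minimizer set is
unchanged. -/
theorem mem_intrinsicInterior_cellOf {η : A → ℝ} {u : V →L[ℝ] ℝ} (hA : A.Nonempty) :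
    u ∈ intrinsicInterior ℝ (cellOf η (argminSet η u)) := by
  obtain ⟨b, hb⟩ := argminSet_nonempty hA η u
  set M := argminSet η u with hM
  let E : AffineSubspace ℝ (V →L[ℝ] ℝ) :=
    { carrier := {w | ∀ a : A, a ∈ M → w (a : V) + η a = w (b : V) + η b}
      smul_vsub_vadd_mem' := by
        intro c p q r hp hq hr a ha
        have := hp a ha
        have := hq a ha
        have := hr a ha
        have e : p (a : V) - q (a : V) = p (b : V) - q (b : V) := by linarith
        simp only [vsub_eq_sub, vadd_eq_add, add_apply,
          smul_apply, sub_apply, smul_eq_mul, e]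
        linarith }
  have hspan : affineSpan ℝ (cellOf η M) ≤ E := by
    refine affineSpan_le.2 fun w hw a ha => le_antisymm (hw ha b) (hw hb a)
  have hN : IsOpen {w : V →L[ℝ] ℝ | ∀ a : A, a ∉ M → w (b : V) + η b < w (a : V) + η a} := by
    simp only [ofPred_forall]
    refine isOpen_iInter_of_finite fun a => isOpen_iInter_of_finite fun _ => ?_
    exact isOpen_lt (by fun_prop) (by fun_prop)
  have hu : u ∈ cellOf η M := Subset.rfl
  refine mem_intrinsicInterior.2 ⟨⟨u, subset_affineSpan ℝ _ hu⟩, ?_, rfl⟩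
  refine mem_interior.2 ⟨_, ?_, hN.preimage continuous_subtype_val, ?_⟩
  · rintro ⟨w, hw⟩ hwN
    exact (argminSet_eq_of_forall (hspan hw) hwN).ge
  · exact fun a ha => lt_of_mem_of_notMem_argminSet hb ha

theorem exists_add_smul_mem_of_mem_intrinsicInterior {E : Type*} [NormedAddCommGroup E]
    [NormedSpace ℝ E] {s : Set E} {x y : E} (hx : x ∈ intrinsicInterior ℝ s) (hy : y ∈ s) :
    ∃ t : ℝ, 0 < t ∧ x + t • (x - y) ∈ s := by
  obtain ⟨x', hx', rfl⟩ := mem_intrinsicInterior.1 hx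
  have hmem : ∀ t : ℝ, (x' : E) + t • ((x' : E) - y) ∈ affineSpan ℝ s := fun t => by
    have := (affineSpan ℝ s).smul_vsub_vadd_mem t x'.2 (subset_affineSpan ℝ _ hy) x'.2
    rwa [vsub_eq_sub, vadd_eq_add, add_comm] at this
  have hcont : Continuous fun t : ℝ => (⟨_, hmem t⟩ : affineSpan ℝ s) := by
    refine Continuous.subtype_mk ?_ _
    fun_prop
  have h0 : (⟨_, hmem 0⟩ : affineSpan ℝ s) = x' := by
    ext; simp
  have hev : ∀ᶠ t : ℝ in nhds 0, (⟨_, hmem t⟩ : affineSpan ℝ s) ∈ interior ((↑) ⁻¹' s) :=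
    hcont.continuousAt.eventually_mem (isOpen_interior.mem_nhds (by rwa [h0]))
  obtain ⟨t, ht, hpos⟩ := ((hev.filter_mono nhdsWithin_le_nhds).and
    (self_mem_nhdsWithin : Ioi (0 : ℝ) ∈ nhdsWithin 0 (Ioi 0))).exists
  have h := interior_subset ht
  exact ⟨t, hpos, h⟩

/-- If `a` is minimal at `u` but not at some `v` in the cell, then prolonging the segment from `v`
slightly beyond `u` makes `a` strictly better than `b`, while staying in the cell, where `b` is
minimal. -/
theorem argminSet_eq_of_mem_intrinsicInterior {η : A → ℝ} {σ : Set (V →L[ℝ] ℝ)}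
    (hσ : σ ∈ tropicalComplex η) {u : V →L[ℝ] ℝ} (hu : u ∈ intrinsicInterior ℝ σ) :
    argminSet η u = tropicalMarking η σ := by
  have huσ := intrinsicInterior_subset hu
  refine Subset.antisymm (fun a ha => ?_) fun a ha => mem_tropicalMarking_iff.1 ha u huσ
  refine mem_tropicalMarking_iff.2 fun v hv => ?_
  obtain ⟨-, B, ⟨b, hb⟩, rfl⟩ := mem_tropicalComplex_iff.1 hσ
  by_contra hav
  obtain ⟨t, ht, hmem⟩ := exists_add_smul_mem_of_mem_intrinsicInterior hu hv
  have h1 := lt_of_mem_of_notMem_argminSet (hv hb) hav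
  have h2 := hmem hb a
  have h3 := ha b
  simp only [add_apply, smul_apply,
    sub_apply, smul_eq_mul] at h2
  nlinarith

theorem mem_intrinsicInterior_iff (hA : A.Nonempty) {η : A → ℝ} {σ : Set (V →L[ℝ] ℝ)}
    (hσ : σ ∈ tropicalComplex η) {u : V →L[ℝ] ℝ} :
    u ∈ intrinsicInterior ℝ σ ↔ argminSet η u = tropicalMarking η σ := by
  refine ⟨argminSet_eq_of_mem_intrinsicInterior hσ, fun h => ?_⟩
  have := mem_intrinsicInterior_cellOf (η := η) (u := u) hA
  rwa [h, cellOf_tropicalMarking hσ] at this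

theorem tropicalMarking_mem_range [FiniteDimensional ℝ V] {η : A → ℝ} {σ : Set (V →L[ℝ] ℝ)}
    (hσ : σ ∈ tropicalComplex η) : tropicalMarking η σ ∈ range (argminSet η) := by
  obtain ⟨hne, B, -, hB⟩ := mem_tropicalComplex_iff.1 hσ
  have hconv : Convex ℝ σ := hB ▸ convex_cellOf η B
  obtain ⟨u, hu⟩ := hne.intrinsicInterior hconv
  exact ⟨u, argminSet_eq_of_mem_intrinsicInterior hσ hu⟩

/-- The anti-isomorphism between the cells of `P_η` and their markings. -/
def cellEquivMarking [FiniteDimensional ℝ V] (hA : A.Nonempty) (η : A → ℝ) :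
    tropicalComplex η ≃o (range (argminSet η))ᵒᵈ where
  toFun σ := OrderDual.toDual ⟨tropicalMarking η σ, tropicalMarking_mem_range σ.2⟩
  invFun M := ⟨cellOf η (OrderDual.ofDual M).1, by
    obtain ⟨_, u, rfl⟩ := M
    exact cellOf_argminSet_mem hA η u⟩
  left_inv σ := Subtype.ext (cellOf_tropicalMarking σ.2)
  right_inv M := by
    obtain ⟨_, u, rfl⟩ := M
    exact Subtype.ext (tropicalMarking_cellOf_argminSet η u)
  map_rel_iff' := by
    intro σ τ
    change tropicalMarking η τ ⊆ tropicalMarking η σ ↔ (σ : Set (V →L[ℝ] ℝ)) ⊆ τ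
    refine ⟨fun h => ?_, fun h a ha => ?_⟩
    · rw [← cellOf_tropicalMarking σ.2, ← cellOf_tropicalMarking τ.2]
      exact fun u hu => h.trans hu
    · rw [mem_tropicalMarking_iff] at ha ⊢
      exact fun u hu => ha u (h hu)

end Cells

/-! ### Signs of the gap and isotopy of paintings -/

section Signature

variable {V : Type*} [NormedAddCommGroup V] [NormedSpace ℝ V] {A : Finset V}

/-- The difference of `f_η` and `u ↦ u(α) + c`. -/
def paintingGap (α : V) (p : (A → ℝ) × ℝ) (u : V →L[ℝ] ℝ) : ℝ :=
  tropicalPoly p.1 u - (u α + p.2)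

/-- The pairs of a marking of a cell of `P_η` and a sign of `f_η(u) - u(α) - c` attained on the
relative interior of that cell. -/
def signature (α : V) (p : (A → ℝ) × ℝ) : Set (Set A × SignType) :=
  range fun u : V →L[ℝ] ℝ => (argminSet p.1 u, SignType.sign (paintingGap α p u))

theorem mem_signature {α : V} {p : (A → ℝ) × ℝ} {M : Set A} {s : SignType} :
    (M, s) ∈ signature α p ↔
      ∃ u, argminSet p.1 u = M ∧ SignType.sign (paintingGap α p u) = s := by
  simp only [signature, mem_range, Prod.mk.injEq]

theorem paintingGap_eq {α : V} {p : (A → ℝ) × ℝ} {u : V →L[ℝ] ℝ} {b : A}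
    (hb : b ∈ argminSet p.1 u) : paintingGap α p u = u (b : V) + p.1 b - (u α + p.2) := by
  rw [paintingGap, tropicalPoly_eq_of_mem hb]

theorem mem_range_argminSet_iff {α : V} {p : (A → ℝ) × ℝ} {M : Set A} :
    M ∈ range (argminSet p.1) ↔ ∃ s, (M, s) ∈ signature α p := by
  simp only [mem_signature]
  exact ⟨fun ⟨u, hu⟩ => ⟨_, u, hu, rfl⟩, fun ⟨_, u, hu, _⟩ => ⟨u, hu⟩⟩

open Classical in
/-- The color determined by the set of signs attained by `f_η(u) - u(α) - c` on a cell. -/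
def colorOfSigns (S : Set SignType) : Color :=
  if ∀ s ∈ S, s = -1 then Color.blue else if 0 ∈ S then Color.purple else Color.red

theorem cellColor_eq (hA : A.Nonempty) {α : V} {p : (A → ℝ) × ℝ} {σ : Set (V →L[ℝ] ℝ)}
    (hσ : σ ∈ tropicalComplex p.1) :
    cellColor α p.1 p.2 σ = colorOfSigns {s | (tropicalMarking p.1 σ, s) ∈ signature α p} := by
  have h1 : (∀ u ∈ intrinsicInterior ℝ σ, tropicalPoly p.1 u < u α + p.2) ↔
      ∀ s ∈ {s | (tropicalMarking p.1 σ, s) ∈ signature α p}, s = -1 := by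
    simp only [mem_intrinsicInterior_iff hA hσ, mem_ofPred_eq, mem_signature]
    constructor
    · rintro h _ ⟨u, hu, rfl⟩
      exact sign_eq_neg_one_iff.2 (sub_neg.2 (h u hu))
    · intro h u hu
      exact sub_neg.1 (sign_eq_neg_one_iff.1 (h _ ⟨u, hu, rfl⟩))
  have h2 : (∃ u ∈ intrinsicInterior ℝ σ, tropicalPoly p.1 u = u α + p.2) ↔
      0 ∈ {s | (tropicalMarking p.1 σ, s) ∈ signature α p} := by
    simp only [mem_intrinsicInterior_iff hA hσ, mem_ofPred_eq, mem_signature, sign_eq_zero_iff,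
      paintingGap, sub_eq_zero]
  classical
  simp only [cellColor, colorOfSigns, h1, h2]

/-- The functionals with minimizer set `M` form a convex set on which the gap is affine; the convex
combination of the two points with weights `y / (y - x)` and `-x / (y - x)` is its zero. -/
theorem zero_mem_signature_of_neg_of_pos (hA : A.Nonempty) {α : V} {p : (A → ℝ) × ℝ} {M : Set A}
    (hn : (M, -1) ∈ signature α p) (hp : (M, 1) ∈ signature α p) : (M, 0) ∈ signature α p := by
  obtain ⟨u, rfl, hu⟩ := mem_signature.1 hn
  obtain ⟨v, hv, hv'⟩ := mem_signature.1 hp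
  obtain ⟨b, hb⟩ := argminSet_nonempty hA p.1 u
  have hbv := hb
  rw [← hv] at hbv
  rw [sign_eq_neg_one_iff] at hu
  rw [sign_eq_one_iff] at hv'
  set x := paintingGap α p u with hx
  set y := paintingGap α p v with hy
  rw [paintingGap_eq hb] at hx
  rw [paintingGap_eq hbv] at hy
  have hxy : 0 < y - x := by linarith
  have hst : y / (y - x) + -x / (y - x) = 1 := by field_simp; ring
  have hs : 0 < y / (y - x) := div_pos hv' hxy
  have ht : 0 < -x / (y - x) := div_pos (by linarith) hxy
  have hzero : y / (y - x) * x + -x / (y - x) * y = 0 := by field_simp; ring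
  generalize y / (y - x) = s at hst hs hzero
  generalize -x / (y - x) = t at hst ht hzero
  have e3 : ∀ r : ℝ, r = s * r + t * r := fun r => by rw [← add_mul, hst, one_mul]
  have harg : argminSet p.1 (s • u + t • v) = argminSet p.1 u := by
    refine argminSet_eq_of_forall (b := b) (fun a ha => ?_) (fun a ha => ?_)
    · have hav := ha
      rw [← hv] at hav
      have e1 : u (a : V) + p.1 a = u (b : V) + p.1 b := le_antisymm (ha b) (hb a)
      have e2 : v (a : V) + p.1 a = v (b : V) + p.1 b := le_antisymm (hav b) (hbv a)
      simp only [add_apply, smul_apply, smul_eq_mul]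
      linear_combination s * e1 + t * e2 + e3 (p.1 a) - e3 (p.1 b)
    · have hav := ha
      rw [← hv] at hav
      have e1 := mul_lt_mul_of_pos_left (lt_of_mem_of_notMem_argminSet hb ha) hs
      have e2 := mul_lt_mul_of_pos_left (lt_of_mem_of_notMem_argminSet hbv hav) ht
      have e4 := e3 (p.1 a)
      have e5 := e3 (p.1 b)
      simp only [add_apply, smul_apply, smul_eq_mul]
      linarith
  refine mem_signature.2 ⟨s • u + t • v, harg, sign_eq_zero_iff.2 ?_⟩
  rw [paintingGap_eq (harg ▸ hb)]
  simp only [add_apply, smul_apply, smul_eq_mul]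
  rw [hx, hy] at hzero
  linear_combination hzero + e3 (p.1 b) - e3 p.2

/-- Purple alone does not say whether the gap vanishes identically on the cell. The marking settles
this: directions along the cell and the linear part of the gap depend only on `M`, so a displacement
from a zero in one painting can be copied, scaled down, at a zero in the other. -/
theorem mem_signature_of_zero_mem (hA : A.Nonempty) {α : V} {p q : (A → ℝ) × ℝ} {M : Set A}
    (hp : (M, 0) ∈ signature α p) (hq : (M, 0) ∈ signature α q) {s : SignType}
    (hs : (M, s) ∈ signature α p) : (M, s) ∈ signature α q := by
  rcases eq_or_ne s 0 with rfl | hs0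
  · exact hq
  obtain ⟨u, rfl, hu⟩ := mem_signature.1 hp
  obtain ⟨v, hv, hv'⟩ := mem_signature.1 hs
  obtain ⟨w, hw, hw'⟩ := mem_signature.1 hq
  obtain ⟨b, hb⟩ := argminSet_nonempty hA p.1 u
  have hbv : b ∈ argminSet p.1 v := hv ▸ hb
  have hbw : b ∈ argminSet q.1 w := hw ▸ hb
  rw [sign_eq_zero_iff, paintingGap_eq hb] at hu
  rw [sign_eq_zero_iff, paintingGap_eq hbw] at hw'
  rw [paintingGap_eq hbv] at hv'
  have hconst : ∀ a : A, a ∈ argminSet q.1 w → (v - u) (a : V) = (v - u) (b : V) := by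
    intro a ha
    rw [hw] at ha
    have hav : a ∈ argminSet p.1 v := hv ▸ ha
    have e1 : u (a : V) + p.1 a = u (b : V) + p.1 b := le_antisymm (ha b) (hb a)
    have e2 : v (a : V) + p.1 a = v (b : V) + p.1 b := le_antisymm (hav b) (hbv a)
    simp only [sub_apply]
    linarith
  obtain ⟨t, ht, hpos⟩ := (((eventually_argminSet_add_smul hbw hconst).filter_mono
    nhdsWithin_le_nhds).and (self_mem_nhdsWithin : Ioi (0 : ℝ) ∈ nhdsWithin 0 (Ioi 0))).exists
  refine mem_signature.2 ⟨w + t • (v - u), ht.trans hw, ?_⟩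
  rw [paintingGap_eq (ht ▸ hbw), ← hv']
  have hval : (w + t • (v - u)) (b : V) + q.1 b - ((w + t • (v - u)) α + q.2) =
      t * (v (b : V) + p.1 b - (v α + p.2)) := by
    simp only [add_apply, smul_apply,
      sub_apply, smul_eq_mul]
    linear_combination hw' - t * hu
  rw [hval, sign_mul, sign_pos hpos, one_mul]

theorem signs_eq_of_color_eq (hA : A.Nonempty) {α : V} {p q : (A → ℝ) × ℝ} {M : Set A}
    (hp : M ∈ range (argminSet p.1)) (hq : M ∈ range (argminSet q.1))
    (h : colorOfSigns {s | (M, s) ∈ signature α p} = colorOfSigns {s | (M, s) ∈ signature α q}) :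
    {s | (M, s) ∈ signature α p} = {s | (M, s) ∈ signature α q} := by
  have key : ∀ {p : (A → ℝ) × ℝ}, M ∈ range (argminSet p.1) →
      (colorOfSigns {s | (M, s) ∈ signature α p} = Color.blue ∧
        {s | (M, s) ∈ signature α p} = {-1}) ∨
      (colorOfSigns {s | (M, s) ∈ signature α p} = Color.purple ∧ (M, 0) ∈ signature α p) ∨
      (colorOfSigns {s | (M, s) ∈ signature α p} = Color.red ∧
        {s | (M, s) ∈ signature α p} = {1}) := by
    intro p hp
    -- An attained sign excludes the empty set, which `colorOfSigns` would call blue.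
    obtain ⟨s₀, hs₀⟩ := (mem_range_argminSet_iff (α := α)).1 hp
    by_cases h1 : ∀ s ∈ {s | (M, s) ∈ signature α p}, s = -1
    · left
      refine ⟨if_pos h1, Subset.antisymm h1 ?_⟩
      rintro _ rfl
      exact h1 _ hs₀ ▸ hs₀
    · right
      by_cases h2 : (M, 0) ∈ signature α p
      · left
        refine ⟨?_, h2⟩
        rw [colorOfSigns, if_neg h1, if_pos (by exact h2)]
      · right
        refine ⟨?_, ?_⟩
        · rw [colorOfSigns, if_neg h1, if_neg (by exact h2)]
        · push Not at h1
          obtain ⟨s, hs, hs1⟩ := h1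
          have hone : (M, 1) ∈ signature α p := by
            rcases SignType.trichotomy s with rfl | rfl | rfl
            · exact absurd rfl hs1
            · exact absurd hs h2
            · exact hs
          refine Subset.antisymm (fun r hr => ?_) ?_
          · rcases SignType.trichotomy r with rfl | rfl | rfl
            · exact absurd (zero_mem_signature_of_neg_of_pos hA hr hone) h2
            · exact absurd hr h2
            · rfl
          · rintro _ rfl
            exact hone
  rcases key hp with ⟨c1, h1⟩ | ⟨c1, h1⟩ | ⟨c1, h1⟩ <;>
    rcases key hq with ⟨c2, h2⟩ | ⟨c2, h2⟩ | ⟨c2, h2⟩ <;> rw [c1, c2] at h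
  · rw [h1, h2]
  · cases h
  · cases h
  · cases h
  · exact Subset.antisymm (fun s hs => mem_signature_of_zero_mem hA h1 h2 hs)
      fun s hs => mem_signature_of_zero_mem hA h2 h1 hs
  · cases h
  · cases h
  · cases h
  · rw [h1, h2]

theorem range_argminSet_eq_of_signature_eq {α : V} {p q : (A → ℝ) × ℝ}
    (h : signature α p = signature α q) : range (argminSet p.1) = range (argminSet q.1) := by
  ext M
  rw [mem_range_argminSet_iff (α := α), mem_range_argminSet_iff (α := α), h]

/-- Cells correspond to their markings with order reversed, so a marking-preserving isomorphism is
forced and isotopy compares the colors of equally marked cells. -/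
theorem paintedIsotopic_iff [FiniteDimensional ℝ V] (hA : A.Nonempty) {α : V}
    {p q : (A → ℝ) × ℝ} : PaintedIsotopic α p q ↔ signature α p = signature α q := by
  constructor
  · rintro ⟨hS, ι, hι, hcol⟩
    rw [coherentSubdivision_eq_iff hA] at hS
    ext ⟨M, s⟩
    by_cases hM : M ∈ range (argminSet p.1)
    · have hMq := hS ▸ hM
      suffices h : {s | (M, s) ∈ signature α p} = {s | (M, s) ∈ signature α q} from
        Set.ext_iff.1 h s
      refine signs_eq_of_color_eq hA hM hMq ?_
      obtain ⟨u, rfl⟩ := hM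
      have h := hcol ⟨_, cellOf_argminSet_mem hA p.1 u⟩
      rw [cellColor_eq hA (ι _).2, hι, cellColor_eq hA (Subtype.prop _)] at h
      simpa only [tropicalMarking_cellOf_argminSet] using h.symm
    · exact iff_of_false (fun h => hM (mem_range_argminSet_iff.2 ⟨s, h⟩))
        fun h => hM (hS ▸ mem_range_argminSet_iff.2 ⟨s, h⟩)
  · intro h
    have hS := range_argminSet_eq_of_signature_eq h
    refine ⟨(coherentSubdivision_eq_iff hA _ _).2 hS, (cellEquivMarking hA p.1).trans
      ((OrderIso.setCongr _ _ hS).dual.trans (cellEquivMarking hA q.1).symm), ?_⟩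
    have hmark : ∀ σ, tropicalMarking q.1 (((cellEquivMarking hA p.1).trans
        ((OrderIso.setCongr _ _ hS).dual.trans (cellEquivMarking hA q.1).symm)) σ :
          Set (V →L[ℝ] ℝ)) = tropicalMarking p.1 σ := by
      intro σ
      obtain ⟨v, hv⟩ : tropicalMarking p.1 (σ : Set (V →L[ℝ] ℝ)) ∈ range (argminSet q.1) :=
        hS ▸ tropicalMarking_mem_range σ.2
      change tropicalMarking q.1 (cellOf q.1 (tropicalMarking p.1 (σ : Set (V →L[ℝ] ℝ)))) = _
      rw [← hv, tropicalMarking_cellOf_argminSet]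
    refine ⟨hmark, fun σ => ?_⟩
    rw [cellColor_eq hA (Subtype.prop _), hmark, cellColor_eq hA σ.2, h]

end Signature

/-! ### The extended configuration and its minimizer sets -/

section ExtendedConfiguration

variable {V : Type*} [NormedAddCommGroup V] {A : Finset V} {α : V}

theorem coe_base (a : A) : (base A α a : V × ℝ) = (↑a, 0) := rfl

theorem coe_rho : (rho A α : V × ℝ) = (α, 1) := rfl

theorem coe_beta : (beta A α : V × ℝ) = (α, 2) := rfl

theorem forall_extendedConfig {P : extendedConfig A α → Prop} :
    (∀ x, P x) ↔ (∀ a, P (base A α a)) ∧ P (rho A α) ∧ P (beta A α) := by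
  refine ⟨fun h => ⟨fun a => h _, h _, h _⟩, ?_⟩
  rintro ⟨h1, h2, h3⟩ ⟨x, hx⟩
  have hx' := hx
  simp only [extendedConfig, Finset.mem_union, Finset.mem_image, Finset.mem_insert,
    Finset.mem_singleton] at hx'
  rcases hx' with ⟨a, ha, rfl⟩ | rfl | rfl
  · exact h1 ⟨a, ha⟩
  · exact h2
  · exact h3

theorem base_injective : Function.Injective (base A α) := fun _ _ h =>
  Subtype.ext (congrArg (fun x : extendedConfig A α => x.1.1) h)

theorem rho_ne_beta : rho A α ≠ beta A α := fun h => by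
  have := congrArg (fun x : extendedConfig A α => x.1.2) h
  norm_num [rho, beta] at this

theorem base_ne_rho (a : A) : base A α a ≠ rho A α := fun h => by
  have := congrArg (fun x : extendedConfig A α => x.1.2) h
  norm_num [rho, base] at this

theorem base_ne_beta (a : A) : base A α a ≠ beta A α := fun h => by
  have := congrArg (fun x : extendedConfig A α => x.1.2) h
  norm_num [beta, base] at this

theorem paintingInclusion_rho (p : (A → ℝ) × ℝ) : paintingInclusion A α p (rho A α) = p.2 := by
  simp [paintingInclusion, rho_ne_beta, (base_ne_rho _).symm]

theorem paintingInclusion_beta (p : (A → ℝ) × ℝ) : paintingInclusion A α p (beta A α) = p.2 := by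
  simp [paintingInclusion, rho_ne_beta.symm, (base_ne_beta _).symm]

theorem paintingInclusion_base (p : (A → ℝ) × ℝ) (a : A) :
    paintingInclusion A α p (base A α a) = p.1 a := by
  classical
  simp [paintingInclusion, Pi.single_apply, base_ne_rho, base_ne_beta,
    (base_injective (A := A) (α := α)).eq_iff]

theorem extendedConfig_nonempty : (extendedConfig A α).Nonempty := ⟨_, (rho A α).2⟩

variable [NormedSpace ℝ V]

/-- The functional on `V × ℝ` with components `u` and `t`. -/
def extendDual (u : V →L[ℝ] ℝ) (t : ℝ) : V × ℝ →L[ℝ] ℝ :=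
  u.comp (ContinuousLinearMap.fst ℝ V ℝ) + t • ContinuousLinearMap.snd ℝ V ℝ

theorem extendDual_apply (u : V →L[ℝ] ℝ) (t : ℝ) (x : V × ℝ) :
    extendDual u t x = u x.1 + t * x.2 := rfl

theorem exists_eq_extendDual (l : V × ℝ →L[ℝ] ℝ) : ∃ u t, l = extendDual u t := by
  refine ⟨l.comp (ContinuousLinearMap.inl ℝ V ℝ), l (0, 1), ContinuousLinearMap.ext fun x => ?_⟩
  rw [extendDual_apply, mul_comm, ← smul_eq_mul, ← map_smul, ContinuousLinearMap.comp_apply,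
    ← map_add]
  congr 1
  ext <;> simp

/-- Relative to `u(α) + c`, the competing values are the gap on the base points, `t` at `ρ` and `2 *
t` at `β`; the two analogues below follow the same comparison. -/
theorem base_mem_argminSet_iff {p : (A → ℝ) × ℝ} {u : V →L[ℝ] ℝ} {t : ℝ} {a : A} :
    base A α a ∈ argminSet (paintingInclusion A α p) (extendDual u t) ↔
      a ∈ argminSet p.1 u ∧ paintingGap α p u ≤ t ∧ paintingGap α p u ≤ 2 * t := by
  simp only [mem_argminSet, forall_extendedConfig, paintingInclusion_base, paintingInclusion_rho,
    paintingInclusion_beta, extendDual_apply, coe_base, coe_rho, coe_beta, mul_zero, add_zero, mul_one]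
  refine and_congr_right fun h => ?_
  rw [paintingGap_eq (mem_argminSet.2 h)]
  constructor <;> rintro ⟨h1, h2⟩ <;> constructor <;> linarith

theorem forall_le_iff_le_paintingGap (hA : A.Nonempty) {p : (A → ℝ) × ℝ} {u : V →L[ℝ] ℝ} {t : ℝ} :
    (∀ a : A, u α + t + p.2 ≤ u (a : V) + p.1 a) ↔ t ≤ paintingGap α p u := by
  obtain ⟨b, hb⟩ := argminSet_nonempty hA p.1 u
  rw [paintingGap_eq hb]
  refine ⟨fun h => ?_, fun h a => ?_⟩
  · have := h b
    linarith
  · have := hb a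
    linarith

theorem rho_mem_argminSet_iff (hA : A.Nonempty) {p : (A → ℝ) × ℝ} {u : V →L[ℝ] ℝ} {t : ℝ} :
    rho A α ∈ argminSet (paintingInclusion A α p) (extendDual u t) ↔
      t ≤ paintingGap α p u ∧ 0 ≤ t := by
  simp only [mem_argminSet, forall_extendedConfig, paintingInclusion_base, paintingInclusion_rho,
    paintingInclusion_beta, extendDual_apply, coe_base, coe_rho, coe_beta, mul_zero, add_zero, mul_one,
    forall_le_iff_le_paintingGap hA, le_refl, true_and]
  refine and_congr_right fun _ => ?_
  constructor <;> intro h <;> linarith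

theorem beta_mem_argminSet_iff (hA : A.Nonempty) {p : (A → ℝ) × ℝ} {u : V →L[ℝ] ℝ} {t : ℝ} :
    beta A α ∈ argminSet (paintingInclusion A α p) (extendDual u t) ↔
      2 * t ≤ paintingGap α p u ∧ t ≤ 0 := by
  simp only [mem_argminSet, forall_extendedConfig, paintingInclusion_base, paintingInclusion_rho,
    paintingInclusion_beta, extendDual_apply, coe_base, coe_rho, coe_beta, mul_zero, add_zero, mul_one,
    forall_le_iff_le_paintingGap hA, le_refl, and_true, mul_comm t 2]
  refine and_congr_right fun _ => ?_
  constructor <;> intro h <;> linarith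

theorem exists_pos_mul_eq_of_sign_eq {x y : ℝ} (h : SignType.sign x = SignType.sign y) :
    ∃ k : ℝ, 0 < k ∧ y = k * x := by
  rcases lt_trichotomy x 0 with hx | rfl | hx
  · rw [sign_neg hx, eq_comm, sign_eq_neg_one_iff] at h
    exact ⟨y / x, div_pos_of_neg_of_neg h hx, (div_mul_cancel₀ y hx.ne).symm⟩
  · rw [sign_zero, eq_comm, sign_eq_zero_iff] at h
    exact ⟨1, one_pos, by rw [h, mul_zero]⟩
  · rw [sign_pos hx, eq_comm, sign_eq_one_iff] at h
    exact ⟨y / x, div_pos h hx, (div_mul_cancel₀ y hx.ne').symm⟩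

theorem range_argminSet_subset_of_signature_subset (hA : A.Nonempty) {p q : (A → ℝ) × ℝ}
    (h : signature α p ⊆ signature α q) :
    range (argminSet (paintingInclusion A α p)) ⊆
      range (argminSet (paintingInclusion A α q)) := by
  rintro _ ⟨l, rfl⟩
  obtain ⟨u, t, rfl⟩ := exists_eq_extendDual l
  obtain ⟨v, hv, hv'⟩ := mem_signature.1 (h (mem_range_self u))
  -- Rescaling `t` by the ratio `k` of the gaps preserves all comparisons between the gap, `t` and
  -- `2 * t`.
  obtain ⟨k, hk, hkg⟩ := exists_pos_mul_eq_of_sign_eq hv'.symm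
  refine ⟨extendDual v (k * t), Set.ext (forall_extendedConfig.2 ⟨fun a => ?_, ?_, ?_⟩)⟩
  · rw [base_mem_argminSet_iff, base_mem_argminSet_iff, hv, hkg, mul_left_comm 2 k t,
      mul_le_mul_iff_right₀ hk, mul_le_mul_iff_right₀ hk]
  · rw [rho_mem_argminSet_iff hA, rho_mem_argminSet_iff hA, hkg, mul_le_mul_iff_right₀ hk,
      mul_nonneg_iff_of_pos_left hk]
  · rw [beta_mem_argminSet_iff hA, beta_mem_argminSet_iff hA, hkg, mul_left_comm 2 k t,
      mul_le_mul_iff_right₀ hk, mul_nonpos_iff_pos_imp_nonpos]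
    refine and_congr_right fun _ => ?_
    constructor
    · exact fun h => h.1 hk
    · exact fun h => ⟨fun _ => h, fun _ => hk.le⟩

theorem signature_subset_of_range_argminSet_subset (hA : A.Nonempty) {p q : (A → ℝ) × ℝ}
    (h : range (argminSet (paintingInclusion A α p)) ⊆
      range (argminSet (paintingInclusion A α q))) :
    signature α p ⊆ signature α q := by
  rintro _ ⟨u, rfl⟩
  set g := paintingGap α p u with hg
  -- Here `t` is chosen so that `min t (2 * t) = g`: `t = g` for `g ≥ 0` and `t = g / 2` for `g <
  -- 0`. The base minimizers then stay minimal, tied with `ρ` exactly when `g ≥ 0` and with `β`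
  -- exactly when `g ≤ 0`.
  obtain ⟨t, h1, h2, h3, h4⟩ : ∃ t : ℝ, g ≤ t ∧ g ≤ 2 * t ∧ (t ≤ g ∧ 0 ≤ t ↔ 0 ≤ g) ∧
      (2 * t ≤ g ∧ t ≤ 0 ↔ g ≤ 0) := by
    rcases le_or_gt 0 g with h0 | h0
    · exact ⟨g, le_rfl, by linarith, by simp,
        fun h => h.2, fun h => ⟨by linarith, h⟩⟩
    · exact ⟨g / 2, by linarith, by linarith,
        ⟨fun h => by linarith [h.2], fun h => by linarith⟩,
        ⟨fun h => h0.le, fun h => ⟨by linarith, by linarith⟩⟩⟩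
  obtain ⟨l, hl⟩ := h (mem_range_self (extendDual u t))
  obtain ⟨v, s, rfl⟩ := exists_eq_extendDual l
  have hbase : ∀ a, _ := fun a => Set.ext_iff.1 hl (base A α a)
  have hrho := Set.ext_iff.1 hl (rho A α)
  have hbeta := Set.ext_iff.1 hl (beta A α)
  simp only [base_mem_argminSet_iff, ← hg, h1, h2, and_true] at hbase
  rw [rho_mem_argminSet_iff hA, rho_mem_argminSet_iff hA, ← hg, h3] at hrho
  rw [beta_mem_argminSet_iff hA, beta_mem_argminSet_iff hA, ← hg, h4] at hbeta
  obtain ⟨b, hb⟩ := argminSet_nonempty hA p.1 u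
  obtain ⟨-, hs, hs'⟩ := (hbase b).2 hb
  refine mem_signature.2 ⟨v, Set.ext fun a => ?_, ?_⟩
  · rw [← hbase a]
    exact ⟨fun h => ⟨h, hs, hs'⟩, fun h => h.1⟩
  · generalize paintingGap α q v = g' at hs hs' hrho hbeta
    change SignType.sign g' = SignType.sign g
    rcases lt_trichotomy g 0 with h0 | h0 | h0
    · obtain ⟨e1, e2⟩ := hbeta.2 h0.le
      rw [sign_neg h0, sign_eq_neg_one_iff]
      by_contra! hc
      exact h0.not_ge (hrho.1 ⟨by linarith, by linarith⟩)
    · obtain ⟨e1, e2⟩ := hbeta.2 h0.le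
      obtain ⟨e3, e4⟩ := hrho.2 h0.ge
      rw [h0, sign_zero, sign_eq_zero_iff]
      linarith
    · obtain ⟨e1, e2⟩ := hrho.2 h0.le
      rw [sign_pos h0, sign_eq_one_iff]
      by_contra! hc
      exact h0.not_ge (hbeta.1 ⟨by linarith, by linarith⟩)

theorem range_argminSet_paintingInclusion_eq_iff (hA : A.Nonempty) {p q : (A → ℝ) × ℝ} :
    range (argminSet (paintingInclusion A α p)) = range (argminSet (paintingInclusion A α q)) ↔
      signature α p = signature α q := by
  constructor
  · exact fun h => (signature_subset_of_range_argminSet_subset hA h.subset).antisymm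
      (signature_subset_of_range_argminSet_subset hA h.superset)
  · exact fun h => (range_argminSet_subset_of_signature_subset hA h.subset).antisymm
      (range_argminSet_subset_of_signature_subset hA h.superset)

/-! ### The lineality direction and the splitting of the secondary fan -/

/-- The restriction to `Ā_α` of the projection `V × ℝ → ℝ`. -/
def height (A : Finset V) (α : V) : extendedConfig A α → ℝ := fun x => (x : V × ℝ).2

theorem argminSet_add_smul_height (η : extendedConfig A α → ℝ) (r : ℝ) (l : V × ℝ →L[ℝ] ℝ) :
    argminSet (η + r • height A α) l =
      argminSet η (l + r • ContinuousLinearMap.snd ℝ V ℝ) := by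
  ext x
  simp only [mem_argminSet, Pi.add_apply, Pi.smul_apply, add_apply, smul_apply,
    ContinuousLinearMap.coe_snd', height, add_assoc, add_comm]

theorem range_argminSet_add_smul_height (η : extendedConfig A α → ℝ) (r : ℝ) :
    range (argminSet (η + r • height A α)) = range (argminSet η) := by
  have : argminSet (η + r • height A α) =
      argminSet η ∘ Equiv.addRight (r • ContinuousLinearMap.snd ℝ V ℝ) :=
    funext fun l => argminSet_add_smul_height η r l
  rw [this, EquivLike.range_comp]

variable (A α) in
/-- The linear isomorphism `((η, c), t) ↦ i(η, c) + t h` with `h` the height function. -/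
def splitting : (((A → ℝ) × ℝ) × ℝ) ≃ₗ[ℝ] (extendedConfig A α → ℝ) :=
  LinearEquiv.ofBijective
    ((paintingInclusion A α).coprod (LinearMap.toSpanSingleton ℝ _ (height A α))) <| by
    constructor
    · rw [← LinearMap.ker_eq_bot, LinearMap.ker_eq_bot']
      rintro ⟨⟨η, c⟩, t⟩ h
      have hr := congrFun h (rho A α)
      have hb := congrFun h (beta A α)
      have ha := fun a => congrFun h (base A α a)
      simp only [LinearMap.coprod_apply, LinearMap.toSpanSingleton_apply, Pi.add_apply,
        paintingInclusion_rho, paintingInclusion_beta, paintingInclusion_base, Pi.smul_apply,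
        height, coe_base, coe_rho, coe_beta, smul_eq_mul, Pi.zero_apply, mul_zero, add_zero, mul_one]
        at hr hb ha
      refine Prod.ext (Prod.ext (funext ha) ?_) ?_
      · change c = 0
        linarith
      · change t = 0
        linarith
    · intro y
      -- Solves `c + t = y(ρ)` and `c + 2t = y(β)`.
      refine ⟨((fun a => y (base A α a), 2 * y (rho A α) - y (beta A α)),
        y (beta A α) - y (rho A α)), funext (forall_extendedConfig.2 ⟨fun a => ?_, ?_, ?_⟩)⟩ <;>
      · simp only [LinearMap.coprod_apply, LinearMap.toSpanSingleton_apply, Pi.add_apply,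
          paintingInclusion_rho, paintingInclusion_beta, paintingInclusion_base, Pi.smul_apply,
          height, coe_base, coe_rho, coe_beta, smul_eq_mul]
        ring

theorem splitting_apply (p : (A → ℝ) × ℝ) (t : ℝ) :
    splitting A α (p, t) = paintingInclusion A α p + t • height A α := rfl

theorem splitting_zero (p : (A → ℝ) × ℝ) :
    splitting A α (p, 0) = paintingInclusion A α p := by
  rw [splitting_apply, zero_smul, add_zero]

theorem openSecondaryCone_splitting [FiniteDimensional ℝ V] (hA : A.Nonempty) (p : (A → ℝ) × ℝ)
    (t : ℝ) :
    openSecondaryCone (coherentSubdivision (splitting A α (p, t))) =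
      splitting A α '' ({q | PaintedIsotopic α p q} ×ˢ univ) := by
  ext y
  obtain ⟨⟨q, s⟩, rfl⟩ := (splitting A α).surjective y
  rw [(splitting A α).injective.mem_set_image]
  simp only [openSecondaryCone, mem_ofPred_eq, mem_prod, mem_univ, and_true,
    coherentSubdivision_eq_iff extendedConfig_nonempty, splitting_apply,
    range_argminSet_add_smul_height, range_argminSet_paintingInclusion_eq_iff hA,
    paintedIsotopic_iff hA]
  exact eq_comm

/-- A linear isomorphism between finite-dimensional spaces is a homeomorphism, so it carries
closures to closures. -/
theorem closure_splitting_image (K : Set ((A → ℝ) × ℝ)) :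
    closure (splitting A α '' (K ×ˢ univ)) = splitting A α '' (closure K ×ˢ univ) := by
  have h := (splitting A α).toContinuousLinearEquiv.toHomeomorph.image_closure
    (K ×ˢ (univ : Set ℝ))
  rw [closure_prod_eq, closure_univ] at h
  exact h.symm

theorem mem_secondaryFan_extendedConfig_iff [FiniteDimensional ℝ V] (hA : A.Nonempty)
    {C : Set (extendedConfig A α → ℝ)} :
    C ∈ secondaryFan (extendedConfig A α) ↔
      ∃ K ∈ paintingFan A α, C = splitting A α '' (K ×ˢ univ) := by
  constructor
  · rintro ⟨_, ⟨η, rfl⟩, rfl⟩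
    obtain ⟨⟨p, t⟩, rfl⟩ := (splitting A α).surjective η
    refine ⟨_, ⟨p, rfl⟩, ?_⟩
    rw [openSecondaryCone_splitting hA, closure_splitting_image]
  · rintro ⟨_, ⟨p, rfl⟩, rfl⟩
    refine ⟨_, ⟨splitting A α (p, 0), rfl⟩, ?_⟩
    rw [openSecondaryCone_splitting hA, closure_splitting_image]

theorem splitting_zero_mem_lineality [FiniteDimensional ℝ V] (hA : A.Nonempty) (t : ℝ) :
    splitting A α (0, t) ∈ lineality (secondaryFan (extendedConfig A α)) := by
  intro C hC r x hx
  obtain ⟨K, -, rfl⟩ := (mem_secondaryFan_extendedConfig_iff hA).1 hC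
  obtain ⟨⟨q, s⟩, ⟨hq, -⟩, rfl⟩ := hx
  refine ⟨(q, s) + r • (0, t), ⟨by simpa using hq, mem_univ _⟩, ?_⟩
  rw [map_add, map_smul]

theorem splitting_image_inter_range (K : Set ((A → ℝ) × ℝ)) :
    splitting A α '' (K ×ˢ univ) ∩ (LinearMap.range (paintingInclusion A α) : Set _) =
      paintingInclusion A α '' K := by
  ext y
  constructor
  · rintro ⟨⟨⟨q, s⟩, ⟨hq, -⟩, rfl⟩, p, hp⟩
    rw [← splitting_zero] at hp
    have h := Prod.mk.inj ((splitting A α).injective hp)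
    refine ⟨q, hq, ?_⟩
    rw [← splitting_zero, h.2]
  · rintro ⟨q, hq, rfl⟩
    exact ⟨⟨(q, 0), ⟨hq, mem_univ _⟩, splitting_zero q⟩, q, rfl⟩

end ExtendedConfiguration

end PaintedTropical

end

theorem mainTheorem1 {V : Type*} [NormedAddCommGroup V] [NormedSpace ℝ V] [FiniteDimensional ℝ V]
    (A : Finset V) (hA : A.Nonempty) (α : V) :
    Function.Injective (PaintedTropical.paintingInclusion A α) ∧
    LinearMap.range (PaintedTropical.paintingInclusion A α) ⊔
        PaintedTropical.lineality
          (PaintedTropical.secondaryFan (PaintedTropical.extendedConfig A α)) = ⊤ ∧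
    {D | ∃ C ∈ PaintedTropical.paintingFan A α, D = PaintedTropical.paintingInclusion A α '' C} =
        PaintedTropical.fanRestrict
          (PaintedTropical.secondaryFan (PaintedTropical.extendedConfig A α))
          (LinearMap.range (PaintedTropical.paintingInclusion A α)) ∧
    ∃ T : (((A → ℝ) × ℝ) × ℝ) ≃ₗ[ℝ] (PaintedTropical.extendedConfig A α → ℝ),
      (∀ p : (A → ℝ) × ℝ, T (p, 0) = PaintedTropical.paintingInclusion A α p) ∧
      (∀ t : ℝ, T (0, t) ∈ PaintedTropical.lineality
          (PaintedTropical.secondaryFan (PaintedTropical.extendedConfig A α))) ∧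
      PaintedTropical.IsFanIso
        (PaintedTropical.fanProdReal (PaintedTropical.paintingFan A α))
        (PaintedTropical.secondaryFan (PaintedTropical.extendedConfig A α)) T := by
  have hmem := fun C => PaintedTropical.mem_secondaryFan_extendedConfig_iff (α := α) hA (C := C)
  have hlin := PaintedTropical.splitting_zero_mem_lineality (α := α) hA
  refine ⟨fun p q h => ?_, ?_, ?_, PaintedTropical.splitting A α,
    PaintedTropical.splitting_zero, hlin, ?_⟩
  · rw [← PaintedTropical.splitting_zero, ← PaintedTropical.splitting_zero] at h
    exact (Prod.mk.inj ((PaintedTropical.splitting A α).injective h)).1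
  · rw [eq_top_iff]
    rintro y -
    obtain ⟨⟨p, t⟩, rfl⟩ := (PaintedTropical.splitting A α).surjective y
    refine Submodule.mem_sup.2 ⟨_, ⟨p, rfl⟩, _, hlin t, ?_⟩
    rw [← PaintedTropical.splitting_zero, ← map_add, Prod.mk_add_mk, add_zero, zero_add]
  · ext D
    constructor
    · rintro ⟨K, hK, rfl⟩
      exact ⟨_, (hmem _).2 ⟨K, hK, rfl⟩, (PaintedTropical.splitting_image_inter_range K).symm⟩
    · rintro ⟨C, hC, rfl⟩
      obtain ⟨K, hK, rfl⟩ := (hmem C).1 hC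
      exact ⟨K, hK, PaintedTropical.splitting_image_inter_range K⟩
  · ext D
    rw [hmem]
    constructor
    · rintro ⟨_, ⟨K, hK, rfl⟩, rfl⟩
      exact ⟨K, hK, rfl⟩
    · rintro ⟨K, hK, rfl⟩
      exact ⟨_, ⟨K, hK, rfl⟩, rfl⟩
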